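/- Let $q\ge 1$, let $\Theta\subset\mathbb R^q$ be compact, let $\{P_\theta\}_{\theta\in\Theta}$ be a family of probability measures on a measurable space $\mathfrak X$, let $\theta_0\in\mathbb R^q$ and let $k\ge 1$ be an integer. For $j\ge1$ let $\mathcal E_j(\Theta)$ (respectively $\mathcal G_j(\Theta)$) be the set of discrete probability measures on $\Theta$ with exactly (respectively at most) $j$ distinct atoms. For $G=\sum_i p_i\delta_{\theta_i}$ put $P_G=\sum_i p_iP_{\theta_i}$ and, for a multi-index $\alpha\in\mathbb N^q$, $m_\alpha(G-\theta_0)=\sum_i p_i(\theta_i-\theta_0)^\alpha$. For $\ell\ge1$ let $W_\ell$ be the Wasserstein distance of order $\ell$ with respect to the Euclidean distance, i.e. $W_\ell^\ell(\sum_i p_i\delta_{\theta_i},\sum_j p_j'\delta_{\theta_j'})=\min_{(q_{ij})}\sum_{i,j}q_{ij}\|\theta_i-\theta'_j\|_2^\ell$ over the joint distributions $(q_{ij})$ with marginals $(p_i)$ and $(p'_j)$. Let $\mathcal I=\{\alpha\in\mathbb N^q: |\alpha|\le 2k-1\}$. Suppose that for each $\alpha\in\mathcal I$ there is a real-valued function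 $t_\alpha$ on $\mathfrak X$ such that, for every $G\in\mathcal G_k(\Theta)$, the expectation $\mathbb E_G\,t_\alpha(X)$ under $X\sim P_G$ exists and equals $m_\alpha(G-\theta_0)$. Given data $X_1,\dots,X_n$ ($n\ge1$), let $\bar t_\alpha=\frac1n\sum_{i=1}^n t_\alpha(X_i)$, and let $\hat G_n=\hat G_n(X_1,\dots,X_n)$ be any generalized method of moments estimator: $$\hat G_n\in\operatorname*{arg\,min}_{G'\in\mathcal G_k(\Theta)}\ \sup_{\alpha\in\mathcal I}\bigl|m_\alpha(G'-\theta_0)-\bar t_\alpha\bigr| .$$ Let $\mathbb P_{G^*}$ and $\mathbb E_{G^*}$ denote probability and expectation when $X_1,\dots,X_n$ are i.i.d. with law $P_{G^*}$; for non-measurable events or functions they are understood as outer probability and outer expectation. Put $D_n(G^*)=\sup_{\alpha\in\mathcal I}|\bar t_\alpha-m_\alpha(G^*-\theta_0)|$. (a) There are constants $C,c>0$, depending only on $\Theta$, $k$, $\theta_0$ and $\{P_\theta\}$ (not on the functions $t_\alpha$, on $n$ or on the choice of $\hat G_n$), such that for every $G^*\in\mathcal G_k(\Theta)$ and every real $t$,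 $$\mathbb P_{G^*}\bigl(W_{2k-1}^{2k-1}(G^*,\hat G_n)\ge t\bigr)\le \mathbb P_{G^*}\bigl(D_n(G^*)\ge C\,t\bigr) \quad\text{and}\quad \mathbb E_{G^*}W_{2k-1}^{2k-1}(G^*,\hat G_n)\le c\,\mathbb E_{G^*}D_n(G^*).$$ (b) Let $1\le k_0\le k$, let $G_0\in\mathcal E_{k_0}(\Theta)$ and let $d_1=k-k_0+1$. There are constants $r,C,c>0$, depending only on $G_0$, $\Theta$, $k_0$, $k$, $\theta_0$ and $\{P_\theta\}$ (not on the functions $t_\alpha$, on $n$ or on the choice of $\hat G_n$), such that for every $G^*\in\mathcal G_k(\Theta)$ with $W_1(G_0,G^*)<r$ and every real $t$, $$\mathbb P_{G^*}\bigl(W_{2d_1-1}^{2d_1-1}(G^*,\hat G_n)\ge t\bigr)\le \mathbb P_{G^*}\bigl(D_n(G^*)\ge C\min(t,1)\bigr) \quad\text{and}\quad \mathbb E_{G^*}W_{2d_1-1}^{2d_1-1}(\hat G_n,G^*)\le c\,\mathbb E_{G^*}D_n(G^*).$$ -/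

import Mathlib

open MeasureTheory
open scoped ENNReal

noncomputable section

namespace MixtureGMM

/-- Parameters live in `ℝ^q` with the Euclidean norm. -/
abbrev Param (q : ℕ) : Type := EuclideanSpace ℝ (Fin q)

variable {q : ℕ} {Θ : Set (Param q)} {X : Type*} [MeasurableSpace X]

/-! ### Discrete mixing measures

A finite discrete (signed) measure `∑ p_i δ_{θ_i}` on `Θ` with distinct atoms is represented by
the finitely supported function `G : Θ →₀ ℝ` with `G θ_i = p_i`; its atoms are `G.support`. -/

/-- `G` is a discrete probability distribution on `Θ`. -/
def IsMixing (G : Θ →₀ ℝ) : Prop :=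
  (∀ θ, 0 ≤ G θ) ∧ ∑ θ ∈ G.support, G θ = 1

/-- The discrete probability distributions on `Θ` with exactly `k` distinct atoms. -/
def exactAtoms (Θ : Set (Param q)) (k : ℕ) : Set (Θ →₀ ℝ) :=
  {G | IsMixing G ∧ G.support.card = k}

/-- The discrete probability distributions on `Θ` with at most `k` distinct atoms. -/
def atMostAtoms (Θ : Set (Param q)) (k : ℕ) : Set (Θ →₀ ℝ) :=
  {G | IsMixing G ∧ G.support.card ≤ k}

/-- The mixture distribution `P_G = ∑ p_i P_{θ_i}` induced by the mixing measure `G`. -/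
def mixture (P : Θ → Measure X) (G : Θ →₀ ℝ) : Measure X :=
  ∑ θ ∈ G.support, ENNReal.ofReal (G θ) • P θ

/-! ### Wasserstein distances -/

/-- `Q` is a joint probability distribution on the pairs of atoms of `G` and `H` with marginals
`G` and `H` (only the values of `Q` at pairs of atoms matter). -/
def IsCoupling (G H : Θ →₀ ℝ) (Q : Θ → Θ → ℝ) : Prop :=
  (∀ θ ∈ G.support, ∀ η ∈ H.support, 0 ≤ Q θ η) ∧
  (∀ θ ∈ G.support, ∑ η ∈ H.support, Q θ η = G θ) ∧
  (∀ η ∈ H.support, ∑ θ ∈ G.support, Q θ η = H η)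

/-- The cost `∑ q_{ij} ‖θ_i - θ'_j‖₂ ^ ℓ` of a coupling. -/
def couplingCost (ℓ : ℕ) (G H : Θ →₀ ℝ) (Q : Θ → Θ → ℝ) : ℝ :=
  ∑ θ ∈ G.support, ∑ η ∈ H.support, Q θ η * ‖(θ : Param q) - (η : Param q)‖ ^ ℓ

/-- The Wasserstein distance `W_ℓ(G, H)` of order `ℓ ≥ 1` with respect to the Euclidean
distance. -/
def wasserstein (ℓ : ℕ) (G H : Θ →₀ ℝ) : ℝ :=
  (sInf (couplingCost ℓ G H '' {Q | IsCoupling G H Q})) ^ (1 / (ℓ : ℝ))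

/-! ### Moments -/

/-- The multi-indices `α ∈ ℕ^q` with `|α| ≤ m`. -/
abbrev MultiIndex (q m : ℕ) : Type := {α : Fin q → ℕ // ∑ i, α i ≤ m}

instance (q m : ℕ) : Finite (MultiIndex q m) := by
  refine Finite.of_injective
    (fun (α : MultiIndex q m) (i : Fin q) =>
      (⟨α.1 i, Nat.lt_succ_of_le
        ((Finset.single_le_sum (fun j _ => Nat.zero_le (α.1 j)) (Finset.mem_univ i)).trans
          α.2)⟩ : Fin (m + 1))) ?_
  intro α β h
  apply Subtype.ext
  funext i
  simpa using congrFun h i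

/-- The moment `m_α(G - θ₀) = ∑ p_i (θ_i - θ₀)^α`. -/
def centeredMoment (θ₀ : Param q) (α : Fin q → ℕ) (G : Θ →₀ ℝ) : ℝ :=
  ∑ θ ∈ G.support, G θ * ∏ i, ((θ : Param q) i - θ₀ i) ^ α i

/-- `sup_{|α| ≤ m} |m_α(G - θ₀) - v_α|`, a maximum over a finite non-empty set. -/
def momentDist {m : ℕ} (θ₀ : Param q) (G : Θ →₀ ℝ) (v : MultiIndex q m → ℝ) : ℝ :=
  ⨆ α : MultiIndex q m, |centeredMoment θ₀ α.1 G - v α|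

/-! ### The generalized method of moments -/

/-- The statistics `t_α`, `|α| ≤ 2k - 1`, are unbiased: for every `G` with at most `k` atoms,
`E_G t_α(X)` exists and equals `m_α(G - θ₀)`. -/
def IsUnbiased (P : Θ → Measure X) (θ₀ : Param q) (k : ℕ)
    (T : MultiIndex q (2 * k - 1) → X → ℝ) : Prop :=
  ∀ α, ∀ G ∈ atMostAtoms Θ k,
    Integrable (T α) (mixture P G) ∧ ∫ x, T α x ∂(mixture P G) = centeredMoment θ₀ α.1 G

/-- The empirical moments `(1/n) ∑ t_α(x_i)` of the sample `x`. -/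
def empMoment {m n : ℕ} (T : MultiIndex q m → X → ℝ) (x : Fin n → X) (α : MultiIndex q m) : ℝ :=
  (1 / (n : ℝ)) * ∑ i, T α (x i)

/-- `Ghat` is an output of the generalized method of moments: for every sample `x`, `Ghat x` is a
minimizer of `‖m_{2k-1}(G' - θ₀) - t̄(x)‖_∞` over the mixing measures `G'` on `Θ` with at most `k`
atoms. -/
def IsGMM (θ₀ : Param q) (k n : ℕ) (T : MultiIndex q (2 * k - 1) → X → ℝ)
    (Ghat : (Fin n → X) → (Θ →₀ ℝ)) : Prop :=
  ∀ x, Ghat x ∈ atMostAtoms Θ k ∧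
    ∀ G' ∈ atMostAtoms Θ k,
      momentDist θ₀ (Ghat x) (empMoment T x) ≤ momentDist θ₀ G' (empMoment T x)

/-- The law of an i.i.d. sample of size `n` from `P_G`. A measure of a non-measurable set is
the outer measure in Mathlib, so this also gives outer probabilities. -/
def sampleLaw (P : Θ → Measure X) (n : ℕ) (G : Θ →₀ ℝ) : Measure (Fin n → X) :=
  Measure.pi (fun _ => mixture P G)

end MixtureGMM

/-- The outer expectation of a non-negative, possibly non-measurable, real function `f`: the
infimum of the expectations of its measurable majorants. For measurable `f` it is the
expectation. -/
def MixtureGMM.outerExp {Ω : Type*} [MeasurableSpace Ω] (μ : Measure Ω) (f : Ω → ℝ) : ℝ≥0∞ :=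
  ⨅ (g : Ω → ℝ≥0∞) (_ : Measurable g) (_ : ∀ ω, ENNReal.ofReal (f ω) ≤ g ω), ∫⁻ ω, g ω ∂μ

end

/-! The statement reduces to a deterministic inequality `W_ℓ ^ ℓ ≤ C δ`, where `δ` bounds the
differences of all moments of order at most `2k - 1` of two mixing measures. Minimality of the
estimator gives `δ ≤ 2 D_n` for every sample, and the probability and expectation bounds follow
pointwise in the sample.

For the inequality, the at most `2k` atoms are projected to a line along which all their pairwise
distances survive up to a constant (`exists_direction`). The comonotone coupling of the projected
measures costs at most a constant times the sum over gaps of `gap ^ ℓ * |F - H|`, with `F`, `H` the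
cumulative functions (`comonotone_cost_le`). At a gap, `F - H` is the integral of a step function
against the difference of the measures; the step is interpolated by a polynomial of degree at most
`2k - 1`. Neville's scheme divides by a possibly small gap at most `ℓ` times, provided that at most
`ℓ + 1` points are ever clustered (`exists_controlled_step`), so `gap ^ ℓ` absorbs the loss
(`exists_wasserstein_pow_le`).

Globally `ℓ + 1 = 2k` serves. Near `G₀` each measure must keep an atom near every atom of `G₀`, so a
cluster holds at most `d₁` atoms of each and `ℓ + 1 = 2 d₁` serves. -/

namespace MixtureGMM

/-! ### Directions in which finitely many vectors are uniformly visible -/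

/-- Coordinates of `u` are chosen one at a time among the integers `0, …, N`. Each vector spoils at
most one of these `N + 1` values, so a good one remains. -/
theorem exists_direction {q : ℕ} (N : ℕ) (J : Finset (Fin q)) :
    ∃ c : ℝ, 0 < c ∧ ∀ T : Finset (Fin q → ℝ), T.card ≤ N →
      ∃ u : Fin q → ℝ, (∀ i, |u i| ≤ N) ∧
        ∀ v ∈ T, c * ∑ i ∈ J, |v i| ≤ |∑ i ∈ J, u i * v i| := by
  classical
  induction J using Finset.induction_on with
  | empty => exact ⟨1, one_pos, fun T _ => ⟨0, by simp, by simp⟩⟩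
  | insert j J hj ih =>
    obtain ⟨c, hc, h⟩ := ih
    -- `ε` with `2 ε < 1` and `(ε + 2 N ε) / c < 1 - 2 ε`
    set ε : ℝ := min 1 c / (2 * N + 4) with hε
    have hN : (0 : ℝ) ≤ N := Nat.cast_nonneg N
    have hmin : 0 < min 1 c := lt_min one_pos hc
    have hε0 : 0 < ε := by positivity
    have hεmul : ε * (2 * N + 4) = min 1 c := by rw [hε]; field_simp
    refine ⟨ε, hε0, fun T hT => ?_⟩
    obtain ⟨u, hu, hv⟩ := h T hT
    set a : (Fin q → ℝ) → ℝ := fun v => ∑ i ∈ J, u i * v i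
    set s : (Fin q → ℝ) → ℝ := fun v => |v j| + ∑ i ∈ J, |v i|
    have hs : ∀ v, 0 ≤ s v := fun v =>
      add_nonneg (abs_nonneg _) (Finset.sum_nonneg fun _ _ => abs_nonneg _)
    -- every vector excludes at most one integer
    have key : ∀ v ∈ T, ∀ l l' : ℕ, l ≤ N → l < l' → |l * v j + a v| < ε * s v →
        |l' * v j + a v| < ε * s v → False := by
      intro v hvT l l' hl hll h1 h2
      have hl1 : (1 : ℝ) ≤ (l' : ℝ) - l := by
        have : (l : ℝ) + 1 ≤ l' := by exact_mod_cast hll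
        linarith
      have hb : |v j| < 2 * (ε * s v) := by
        have e : ((l' : ℝ) - l) * v j = (l' * v j + a v) - (l * v j + a v) := by ring
        have e2 := abs_sub (l' * v j + a v) (l * v j + a v)
        rw [← e, abs_mul, abs_of_pos (by linarith)] at e2
        nlinarith [abs_nonneg (v j)]
      have ha : |a v| < (1 + 2 * N) * (ε * s v) := by
        have e : a v = (l * v j + a v) - l * v j := by ring
        have e2 := abs_sub (l * v j + a v) (l * v j)
        rw [← e, abs_mul, abs_of_nonneg (Nat.cast_nonneg (α := ℝ) l)] at e2
        have : (l : ℝ) * |v j| ≤ N * |v j| := by gcongr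
        have : (N : ℝ) * |v j| ≤ N * (2 * (ε * s v)) := by gcongr
        linarith
      -- Two bad integers would give `|v j| + |a v| < (2N + 3) ε s v`, while the induction
      -- hypothesis makes the left side at least `min 1 c * s v = (2N + 4) ε s v`.
      have h3 := hv v hvT
      have hσ : 0 ≤ ∑ i ∈ J, |v i| := Finset.sum_nonneg fun _ _ => abs_nonneg _
      have h4 : min 1 c * s v ≤ |v j| + c * ∑ i ∈ J, |v i| := by
        have e1 : min 1 c * |v j| ≤ 1 * |v j| := by gcongr; exact min_le_left _ _
        have e2 : min 1 c * ∑ i ∈ J, |v i| ≤ c * ∑ i ∈ J, |v i| := by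
          gcongr; exact min_le_right _ _
        simp only [s]; linarith
      have : ε * s v * (2 * N + 4) = min 1 c * s v := by rw [← hεmul]; ring
      have h5 : 0 ≤ ε * s v := mul_nonneg hε0.le (hs v)
      simp only [a] at ha
      nlinarith
    have hex : ∃ l : ℕ, l ≤ N ∧ ∀ v ∈ T, ε * s v ≤ |l * v j + a v| := by
      by_contra hcon
      push Not at hcon
      -- The spoiling vector is made a total function of `l`, with junk value `0` beyond `N`, in
      -- order to apply the pigeonhole principle.
      have : ∀ l : ℕ, ∃ v, l ≤ N → v ∈ T ∧ |l * v j + a v| < ε * s v := by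
        intro l
        by_cases hl : l ≤ N
        · obtain ⟨v, hvT, hvl⟩ := hcon l hl
          exact ⟨v, fun _ => ⟨hvT, hvl⟩⟩
        · exact ⟨0, fun h => absurd h hl⟩
      choose b hb using this
      have hcard : T.card < (Finset.range (N + 1)).card := by
        rw [Finset.card_range]; omega
      obtain ⟨l, hl, l', hl', hne, heq⟩ := Finset.exists_ne_map_eq_of_card_lt_of_maps_to hcard
        (f := b) (fun l hl => (hb l (by simpa [Nat.lt_succ_iff] using hl)).1)
      have hlN : l ≤ N := by simpa [Nat.lt_succ_iff] using hl
      have hlN' : l' ≤ N := by simpa [Nat.lt_succ_iff] using hl'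
      obtain ⟨hT1, h1⟩ := hb l hlN
      obtain ⟨-, h2⟩ := hb l' hlN'
      rw [← heq] at h2
      rcases lt_or_gt_of_ne hne with h | h
      · exact key _ hT1 l l' hlN h h1 h2
      · exact key _ hT1 l' l hlN' h h2 h1
    obtain ⟨l, hl, hlT⟩ := hex
    refine ⟨Function.update u j l, fun i => ?_, fun v hvT => ?_⟩
    · by_cases hij : i = j
      · subst hij; simpa using hl
      · simpa [hij] using hu i
    · rw [Finset.sum_insert hj, Finset.sum_insert hj, Function.update_self]
      have : ∑ i ∈ J, Function.update u j (l : ℝ) i * v i = a v :=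
        Finset.sum_congr rfl fun i hi => by
          rw [Function.update_of_ne (ne_of_mem_of_not_mem hi hj)]
      rw [this]
      exact hlT v hvT

/-! ### The comonotone coupling -/

section Comonotone

variable (F H : ℕ → ℝ)

/-- The comonotone coupling of two measures on `ℕ`, in terms of their cumulative functions. -/
def comonotone (i j : ℕ) : ℝ :=
  min (F (i + 1)) (H (j + 1)) - min (F i) (H (j + 1)) - (min (F (i + 1)) (H j) - min (F i) (H j))

variable {F H}

/-- The entries are mixed second differences of `min`, which is supermodular. -/
theorem comonotone_nonneg (hF : Monotone F) (hH : Monotone H) (i j : ℕ) :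
    0 ≤ comonotone F H i j := by
  have h1 := hF (Nat.le_add_right i 1)
  have h2 := hH (Nat.le_add_right j 1)
  unfold comonotone
  grind

theorem sum_comonotone_right (i a b : ℕ) (hab : a ≤ b) :
    ∑ j ∈ Finset.Ico a b, comonotone F H i j =
      min (F (i + 1)) (H b) - min (F i) (H b) - (min (F (i + 1)) (H a) - min (F i) (H a)) :=
  Finset.sum_Ico_sub (fun j => min (F (i + 1)) (H j) - min (F i) (H j)) hab

theorem comonotone_swap (i j : ℕ) : comonotone F H i j = comonotone H F j i := by
  simp only [comonotone, min_comm]; ring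

theorem sum_sum_comonotone (a b m : ℕ) (hab : a ≤ b) :
    ∑ i ∈ Finset.range m, ∑ j ∈ Finset.Ico a b, comonotone F H i j =
      min (F m) (H b) - min (F 0) (H b) - (min (F m) (H a) - min (F 0) (H a)) := by
  simp only [sum_comonotone_right _ _ _ hab, Finset.sum_sub_distrib]
  rw [← Finset.sum_sub_distrib, ← Finset.sum_sub_distrib,
    Finset.sum_range_sub (fun i => min (F i) (H b)), Finset.sum_range_sub (fun i => min (F i) (H a))]

/-- The cost of a pair is charged to the gaps between its indices. Gap `a` lies between `a` and `a +
1`; since `F (a + 1)` is the mass of the indices up to `a`, the coupling carries `F - min F H`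
across it rightwards and `H - min F H` leftwards, both at `a + 1`, in total `|F - H|`. -/
theorem comonotone_cost_le (hF : Monotone F) (hH : Monotone H) (hF0 : F 0 = 0) (hH0 : H 0 = 0)
    {m : ℕ} (hm : F m = H m) (cost : ℕ → ℕ → ℝ) (γ : ℕ → ℝ)
    (hcost : ∀ i j, i ≤ j → j < m → cost i j ≤ ∑ a ∈ Finset.Ico i j, γ a)
    (hsymm : ∀ i j, cost i j = cost j i) :
    ∑ i ∈ Finset.range m, ∑ j ∈ Finset.range m, comonotone F H i j * cost i j ≤
      ∑ a ∈ Finset.range m, γ a * |F (a + 1) - H (a + 1)| := by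
  have hF' : ∀ n, 0 ≤ F n := fun n => hF0 ▸ hF (Nat.zero_le n)
  have hH' : ∀ n, 0 ≤ H n := fun n => hH0 ▸ hH (Nat.zero_le n)
  have crossing : ∀ (F H : ℕ → ℝ), Monotone F → F 0 = 0 → (∀ n, 0 ≤ H n) → F m = H m → ∀ a < m,
      ∑ i ∈ Finset.range m, ∑ j ∈ Finset.range m,
        (if i ≤ a ∧ a < j then comonotone F H i j else 0) =
        F (a + 1) - min (F (a + 1)) (H (a + 1)) := by
    intro F H hF hF0 hH0 hm a ha
    have : ∀ i ∈ Finset.range m, ∑ j ∈ Finset.range m,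
        (if i ≤ a ∧ a < j then comonotone F H i j else 0) =
        if i ∈ Finset.range (a + 1) then
          ∑ j ∈ Finset.Ico (a + 1) m, comonotone F H i j else 0 := by
      intro i _
      by_cases hi : i ≤ a
      · simp only [hi, true_and, Finset.mem_range, Nat.lt_succ_iff, if_true]
        rw [← Finset.sum_filter]
        congr 1
        ext j; simp only [Finset.mem_filter, Finset.mem_range, Finset.mem_Ico]; omega
      · simp [hi]
    rw [Finset.sum_congr rfl this, ← Finset.sum_filter]
    have hfil : (Finset.range m).filter (· ∈ Finset.range (a + 1)) = Finset.range (a + 1) := by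
      ext j; simp only [Finset.mem_filter, Finset.mem_range]; omega
    rw [hfil, sum_sum_comonotone _ _ _ ha, hF0, ← hm, min_eq_left (hF ha),
      min_eq_left (hF0 ▸ hF (Nat.zero_le m)), min_eq_left (hH0 _)]
    ring
  have hpt : ∀ i ∈ Finset.range m, ∀ j ∈ Finset.range m, comonotone F H i j * cost i j ≤
      ∑ a ∈ Finset.range m, γ a * ((if i ≤ a ∧ a < j then comonotone F H i j else 0) +
        (if j ≤ a ∧ a < i then comonotone F H i j else 0)) := by
    intro i hi j hj
    rw [Finset.mem_range] at hi hj
    have hQ := comonotone_nonneg hF hH i j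
    rcases le_total i j with hij | hij
    · refine (mul_le_mul_of_nonneg_left (hcost i j hij hj) hQ).trans (le_of_eq ?_)
      have hs : Finset.Ico i j = (Finset.range m).filter (fun a => i ≤ a ∧ a < j) := by
        ext a; simp only [Finset.mem_filter, Finset.mem_range, Finset.mem_Ico]; omega
      rw [Finset.mul_sum, hs, Finset.sum_filter]
      refine Finset.sum_congr rfl fun a _ => ?_
      have : ¬ (j ≤ a ∧ a < i) := by omega
      rw [if_neg this]; split_ifs <;> ring
    · rw [hsymm]
      refine (mul_le_mul_of_nonneg_left (hcost j i hij hi) hQ).trans (le_of_eq ?_)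
      have hs : Finset.Ico j i = (Finset.range m).filter (fun a => j ≤ a ∧ a < i) := by
        ext a; simp only [Finset.mem_filter, Finset.mem_range, Finset.mem_Ico]; omega
      rw [Finset.mul_sum, hs, Finset.sum_filter]
      refine Finset.sum_congr rfl fun a _ => ?_
      have : ¬ (i ≤ a ∧ a < j) := by omega
      rw [if_neg this]; split_ifs <;> ring
  refine (Finset.sum_le_sum fun i hi => Finset.sum_le_sum fun j hj => hpt i hi j hj).trans
    (le_of_eq ?_)
  have : ∀ i ∈ Finset.range m, ∑ j ∈ Finset.range m, ∑ a ∈ Finset.range m,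
      γ a * ((if i ≤ a ∧ a < j then comonotone F H i j else 0) +
        (if j ≤ a ∧ a < i then comonotone F H i j else 0)) =
      ∑ a ∈ Finset.range m, ∑ j ∈ Finset.range m,
      γ a * ((if i ≤ a ∧ a < j then comonotone F H i j else 0) +
        (if j ≤ a ∧ a < i then comonotone F H i j else 0)) := fun _ _ => Finset.sum_comm
  rw [Finset.sum_congr rfl this, Finset.sum_comm]
  refine Finset.sum_congr rfl fun a ha => ?_
  rw [Finset.mem_range] at ha
  simp only [← Finset.mul_sum, Finset.sum_add_distrib]
  congr 1
  rw [crossing F H hF hF0 hH' hm a ha]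
  have h2 := crossing H F hH hH0 hF' hm.symm a ha
  rw [Finset.sum_comm] at h2
  simp only [comonotone_swap (F := H)] at h2
  rw [h2]
  rcases le_total (F (a + 1)) (H (a + 1)) with h | h
  · rw [min_eq_left h, min_eq_right h, abs_of_nonpos (by linarith)]; ring
  · rw [min_eq_right h, min_eq_left h, abs_of_nonneg (by linarith)]; ring

end Comonotone

/-! ### Functionals controlled by moments -/

section Controlled

variable {q : ℕ} {m : ℕ} {ζ : ℕ → Fin q → ℝ}

/-- Integrals of `f` against a signed measure on the points `ζ 0, …, ζ (m - 1)` are at most `B`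
times the largest of its moments of order at most `n`. -/
def Controlled (m : ℕ) (ζ : ℕ → Fin q → ℝ) (n : ℕ) (B : ℝ) (f : ℕ → ℝ) : Prop :=
  ∀ (w : ℕ → ℝ) (δ : ℝ),
    (∀ α : Fin q → ℕ, ∑ i, α i ≤ n → |∑ l ∈ Finset.range m, w l * ∏ i, ζ l i ^ α i| ≤ δ) →
    |∑ l ∈ Finset.range m, w l * f l| ≤ B * δ

theorem Controlled.mono {n n' : ℕ} {B B' : ℝ} {f : ℕ → ℝ} (h : Controlled m ζ n B f)
    (hn : n ≤ n') (hB : B ≤ B') : Controlled m ζ n' B' f := by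
  intro w δ hδ
  have h0 : 0 ≤ δ := (abs_nonneg _).trans (hδ 0 (by simp))
  exact (h w δ fun α hα => hδ α (hα.trans hn)).trans (by gcongr)

theorem controlled_one : Controlled m ζ 0 1 (fun _ => 1) := by
  intro w δ hδ
  simpa using hδ 0 (by simp)

theorem controlled_zero : Controlled m ζ 0 0 (fun _ => 0) := by
  intro w δ _
  simp

theorem Controlled.sub {n : ℕ} {B B' : ℝ} {f g : ℕ → ℝ} (hf : Controlled m ζ n B f)
    (hg : Controlled m ζ n B' g) : Controlled m ζ n (B + B') (fun l => f l - g l) := by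
  intro w δ hδ
  simp only [mul_sub, Finset.sum_sub_distrib]
  refine (abs_sub _ _).trans ?_
  rw [add_mul]
  exact add_le_add (hf w δ hδ) (hg w δ hδ)

theorem Controlled.div {n : ℕ} {B : ℝ} {f : ℕ → ℝ} (hf : Controlled m ζ n B f) {r : ℝ}
    (hr : 0 < r) : Controlled m ζ n (B / r) (fun l => f l / r) := by
  intro w δ hδ
  have : ∑ l ∈ Finset.range m, w l * (f l / r) = (∑ l ∈ Finset.range m, w l * f l) / r := by
    rw [Finset.sum_div]; exact Finset.sum_congr rfl fun _ _ => by ring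
  rw [this, abs_div, abs_of_pos hr, div_mul_eq_mul_div]
  gcongr
  exact hf w δ hδ

/-- The affine factor is absorbed into the weights: moments of the new weights are combinations,
with coefficients `u j` and `b`, of old moments of order at most one higher. -/
theorem Controlled.linear_mul {n : ℕ} {B : ℝ} {f : ℕ → ℝ} (hf : Controlled m ζ n B f)
    (u : Fin q → ℝ) (b : ℝ) :
    Controlled m ζ (n + 1) (B * (∑ i, |u i| + |b|)) (fun l => (∑ i, u i * ζ l i - b) * f l) := by
  classical
  intro w δ hδ
  have h := hf (fun l => w l * (∑ i, u i * ζ l i - b)) ((∑ i, |u i| + |b|) * δ) ?_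
  · simpa only [mul_assoc] using h
  intro α hα
  have e : ∑ l ∈ Finset.range m, w l * (∑ i, u i * ζ l i - b) * ∏ i, ζ l i ^ α i =
      ∑ j, u j * (∑ l ∈ Finset.range m, w l * ∏ i, ζ l i ^ (α + Pi.single j 1 : Fin q → ℕ) i) -
        b * ∑ l ∈ Finset.range m, w l * ∏ i, ζ l i ^ α i := by
    simp only [Finset.mul_sum]
    rw [Finset.sum_comm, ← Finset.sum_sub_distrib]
    refine Finset.sum_congr rfl fun l _ => ?_
    have : ∀ j, ∏ i, ζ l i ^ (α + Pi.single j 1 : Fin q → ℕ) i = ζ l j * ∏ i, ζ l i ^ α i := by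
      intro j
      simp only [Pi.add_apply, pow_add, Finset.prod_mul_distrib]
      rw [mul_comm]
      congr 1
      rw [Finset.prod_eq_single j]
      · simp
      · intro i _ hij; simp [hij]
      · simp
    simp only [this]
    rw [mul_sub, sub_mul, Finset.mul_sum, Finset.sum_mul]
    congr 1
    · exact Finset.sum_congr rfl fun j _ => by ring
    · ring
  rw [e, add_mul]
  refine (abs_sub _ _).trans (add_le_add ?_ ?_)
  · rw [Finset.sum_mul]
    refine (Finset.abs_sum_le_sum_abs _ _).trans (Finset.sum_le_sum fun j _ => ?_)
    rw [abs_mul]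
    gcongr
    refine hδ _ ?_
    simp only [Pi.add_apply, Finset.sum_add_distrib, Finset.sum_pi_single', Finset.mem_univ]
    simpa using hα
  · rw [abs_mul]
    gcongr
    exact hδ α (by omega)

/-- Neville interpolation of the indicator of an initial segment of the points. -/
theorem exists_controlled_step {u : Fin q → ℝ} {x : ℕ → ℝ}
    (hx : ∀ l, x l = ∑ i, u i * ζ l i) (hmono : ∀ i j, i < j → j < m → x i < x j)
    {L D ρ g : ℝ} {ℓ a : ℕ} (hL : ∀ l < m, ∑ i, |u i| + |x l| ≤ L)
    (hg : 0 < g) (hgD : g ≤ D) (hρ : 0 < ρ) (hρD : ρ ≤ D)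
    (hgap : ∀ i j, i ≤ a → a < j → j < m → g ≤ x j - x i)
    (hblock : ∀ i j, i + ℓ < j → j < m → ρ ≤ x j - x i) (s : ℕ) :
    ∀ i, i + s < m → ∃ f : ℕ → ℝ, (∀ l, i ≤ l → l ≤ i + s → f l = if l ≤ a then 1 else 0) ∧
      Controlled m ζ s ((max 1 (2 * L / ρ)) ^ s * (D / g) ^ min s ℓ) f := by
  set E := max 1 (2 * L / ρ) with hE
  have hE1 : 1 ≤ E := le_max_left _ _
  have hDg : 1 ≤ D / g := by rwa [one_le_div hg]
  induction s with
  | zero =>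
    intro i hi
    refine ⟨fun _ => if i ≤ a then 1 else 0, fun l h1 h2 => ?_, ?_⟩
    · obtain rfl : l = i := by omega
      rfl
    · split_ifs
      · simpa using controlled_one
      · exact controlled_zero.mono le_rfl (by simp)
  | succ s ih =>
    intro i hi
    have hbig : 1 ≤ E ^ (s + 1) * (D / g) ^ min (s + 1) ℓ :=
      one_le_mul_of_one_le_of_one_le (one_le_pow₀ hE1) (one_le_pow₀ hDg)
    -- A block on one side of the step is interpolated by a constant, without any division. Only
    -- blocks straddling the gap remain.
    by_cases h1 : i + (s + 1) ≤ a
    · exact ⟨fun _ => 1, fun l _ h => by rw [if_pos (by omega)],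
        controlled_one.mono (Nat.zero_le _) hbig⟩
    by_cases h2 : a < i
    · exact ⟨fun _ => 0, fun l h _ => by rw [if_neg (by omega)],
        controlled_zero.mono (Nat.zero_le _) (by linarith)⟩
    obtain ⟨f₁, hf₁, hc₁⟩ := ih (i + 1) (by omega)
    obtain ⟨f₀, hf₀, hc₀⟩ := ih i (by omega)
    have hpos : 0 < x (i + (s + 1)) - x i := sub_pos.2 (hmono _ _ (by omega) hi)
    -- Neville's recursion: `f₀` omits the last node and `f₁` the first.
    refine ⟨fun l => ((∑ t, u t * ζ l t - x i) * f₁ l -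
      (∑ t, u t * ζ l t - x (i + (s + 1))) * f₀ l) / (x (i + (s + 1)) - x i), fun l hl hl' => ?_, ?_⟩
    · simp only [← hx]
      rw [div_eq_iff hpos.ne']
      rcases hl.eq_or_lt with rfl | hl1
      · rw [hf₀ _ le_rfl (by omega)]; ring
      rcases hl'.eq_or_lt with rfl | hl2
      · rw [hf₁ _ (by omega) (by omega)]; ring
      rw [hf₀ l hl (by omega), hf₁ l (by omega) (by omega)]; ring
    · refine (((hc₁.linear_mul u (x i)).sub (hc₀.linear_mul u (x (i + (s + 1))))).div hpos).mono
        le_rfl ?_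
      set B := E ^ s * (D / g) ^ min s ℓ with hB
      have hB0 : 0 ≤ B := by positivity
      have hL0 : 0 ≤ L := le_trans
        (add_nonneg (Finset.sum_nonneg fun _ _ => abs_nonneg _) (abs_nonneg _)) (hL i (by omega))
      have hnum : B * (∑ t, |u t| + |x i|) + B * (∑ t, |u t| + |x (i + (s + 1))|) ≤ B * (2 * L) := by
        rw [← mul_add]; gcongr; linarith [hL i (by omega), hL _ hi]
      have hEρ : 2 * L ≤ E * ρ := by
        rw [← div_le_iff₀ hρ]; exact le_max_right _ _
      rw [div_le_iff₀ hpos]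
      refine hnum.trans ?_
      -- The divisor is at least `g` because the block straddles the gap, which costs a factor `E *
      -- (D / g)`. Once the block has more than `ℓ + 1` nodes the divisor is at least `ρ`, and the
      -- cost is only `E`.
      by_cases hsl : s + 1 ≤ ℓ
      · rw [min_eq_left hsl]
        rw [min_eq_left (by omega : s ≤ ℓ)] at hB
        have : E ^ (s + 1) * (D / g) ^ (s + 1) = B * (E * (D / g)) := by rw [hB]; ring
        rw [this, mul_assoc B]
        refine mul_le_mul_of_nonneg_left ?_ hB0
        have h3 := hgap i (i + (s + 1)) (by omega) (by omega) hi
        calc 2 * L ≤ E * ρ := hEρ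
          _ ≤ E * D := by gcongr
          _ = E * (D / g) * g := by field_simp
          _ ≤ _ := by gcongr
      · rw [min_eq_right (by omega)]
        rw [min_eq_right (by omega : ℓ ≤ s)] at hB
        have : E ^ (s + 1) * (D / g) ^ ℓ = B * E := by rw [hB]; ring
        rw [this, mul_assoc B]
        refine mul_le_mul_of_nonneg_left (hEρ.trans ?_) hB0
        gcongr
        exact hblock i (i + (s + 1)) (by omega) hi

end Controlled

end MixtureGMM

namespace MixtureGMM

/-! ### Cumulative functions of signed measures with small moments -/

section Cumulative

variable {q : ℕ} {m : ℕ} {ζ : ℕ → Fin q → ℝ}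

/-- A signed measure on few points of the line with small moments has small cumulative function
across large gaps. -/
theorem gap_pow_mul_abs_sum_le {u : Fin q → ℝ} {x : ℕ → ℝ}
    (hx : ∀ l, x l = ∑ i, u i * ζ l i) (hmono : ∀ i j, i < j → j < m → x i < x j)
    {L ρ : ℝ} {ℓ n : ℕ} (hL : ∀ l < m, ∑ i, |u i| + |x l| ≤ L) (hL0 : 0 ≤ L) (hρ : 0 < ρ)
    (hblock : ∀ i j, i + ℓ < j → j < m → ρ ≤ x j - x i) (hn : m ≤ n + 1) {w : ℕ → ℝ} {δ : ℝ}
    (hδ : ∀ α : Fin q → ℕ, ∑ i, α i ≤ n → |∑ l ∈ Finset.range m, w l * ∏ i, ζ l i ^ α i| ≤ δ)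
    {a : ℕ} (ha : a + 1 < m) :
    (x (a + 1) - x a) ^ ℓ * |∑ l ∈ Finset.range (a + 1), w l| ≤
      (max 1 (2 * L / ρ)) ^ n * (2 * L + ρ) ^ ℓ * δ := by
  have h0 : 0 ≤ δ := (abs_nonneg _).trans (hδ 0 (by simp))
  set E := max 1 (2 * L / ρ)
  -- `D` dominates both `ρ` and every gap, since each `|x l|` is at most `L`.
  set D := 2 * L + ρ with hD
  set g := x (a + 1) - x a with hgdef
  have hE1 : 1 ≤ E := le_max_left _ _
  have hg : 0 < g := sub_pos.2 (hmono _ _ (Nat.lt_succ_self a) ha)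
  have hxL : ∀ l < m, |x l| ≤ L := fun l hl =>
    le_trans (le_add_of_nonneg_left (Finset.sum_nonneg fun _ _ => abs_nonneg _)) (hL l hl)
  have hgD : g ≤ D := by
    have h1 := abs_le.1 (hxL (a + 1) ha)
    have h2 := abs_le.1 (hxL a (by omega))
    rw [hD, hgdef]; linarith
  have hmono' : ∀ i j, i ≤ j → j < m → x i ≤ x j := fun i j hij hj =>
    hij.eq_or_lt.elim (fun h => h ▸ le_rfl) fun h => (hmono i j h hj).le
  -- The block of all `m` nodes is used, so the degree is `m - 1 ≤ n`.
  obtain ⟨f, hf, hc⟩ := exists_controlled_step hx hmono hL hg hgD hρ (by linarith)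
    (a := a) (ℓ := ℓ) (fun i j hi hj hjm => by
      have h1 := hmono' (a + 1) j hj hjm
      have h2 := hmono' i a hi (by omega)
      linarith) hblock (m - 1) 0 (by omega)
  have hDg : 1 ≤ D / g := by rwa [one_le_div hg]
  have hB := hc.mono (n' := n) (B' := E ^ n * (D / g) ^ ℓ) (by omega) (by
    gcongr
    · omega
    · exact min_le_right _ _) w δ hδ
  have hsum : ∑ l ∈ Finset.range m, w l * f l = ∑ l ∈ Finset.range (a + 1), w l := by
    have h1 : ∀ l ∈ Finset.range m, w l * f l = if l ∈ Finset.range (a + 1) then w l else 0 := by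
      intro l hl
      rw [Finset.mem_range] at hl
      rw [hf l (Nat.zero_le _) (by omega)]
      by_cases h : l ≤ a
      · simp [h]
      · simp [h]
    rw [Finset.sum_congr rfl h1, ← Finset.sum_filter]
    congr 1
    ext l; simp only [Finset.mem_filter, Finset.mem_range]; omega
  rw [hsum] at hB
  calc g ^ ℓ * |∑ l ∈ Finset.range (a + 1), w l| ≤ g ^ ℓ * (E ^ n * (D / g) ^ ℓ * δ) := by gcongr
    _ = E ^ n * D ^ ℓ * δ := by rw [div_pow]; field_simp

end Cumulative

variable {q : ℕ} {Θ : Set (Param q)}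

/-! ### Elementary facts on couplings -/

theorem couplingCost_nonneg {ℓ : ℕ} {G H : Θ →₀ ℝ} {Q : Θ → Θ → ℝ} (hQ : IsCoupling G H Q) :
    0 ≤ couplingCost ℓ G H Q :=
  Finset.sum_nonneg fun θ hθ => Finset.sum_nonneg fun η hη =>
    mul_nonneg (hQ.1 θ hθ η hη) (by positivity)

theorem sInf_couplingCost_nonneg (ℓ : ℕ) (G H : Θ →₀ ℝ) :
    0 ≤ sInf (couplingCost ℓ G H '' {Q | IsCoupling G H Q}) := by
  refine Real.sInf_nonneg ?_
  rintro _ ⟨Q, hQ, rfl⟩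
  exact couplingCost_nonneg hQ

theorem wasserstein_pow {ℓ : ℕ} (hℓ : 1 ≤ ℓ) (G H : Θ →₀ ℝ) :
    wasserstein ℓ G H ^ ℓ = sInf (couplingCost ℓ G H '' {Q | IsCoupling G H Q}) := by
  rw [wasserstein, one_div]
  exact Real.rpow_inv_natCast_pow (sInf_couplingCost_nonneg ℓ G H) (by omega)

theorem wasserstein_pow_le {ℓ : ℕ} (hℓ : 1 ≤ ℓ) {G H : Θ →₀ ℝ} {Q : Θ → Θ → ℝ}
    (hQ : IsCoupling G H Q) : wasserstein ℓ G H ^ ℓ ≤ couplingCost ℓ G H Q := by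
  rw [wasserstein_pow hℓ]
  refine csInf_le ⟨0, ?_⟩ ⟨Q, hQ, rfl⟩
  rintro _ ⟨Q, hQ, rfl⟩
  exact couplingCost_nonneg hQ

theorem isCoupling_mul {G H : Θ →₀ ℝ} (hG : IsMixing G) (hH : IsMixing H) :
    IsCoupling G H (fun θ η => G θ * H η) := by
  refine ⟨fun θ _ η _ => mul_nonneg (hG.1 θ) (hH.1 η), fun θ _ => ?_, fun η _ => ?_⟩
  · rw [← Finset.mul_sum, hH.2, mul_one]
  · rw [← Finset.sum_mul, hG.2, one_mul]

theorem wasserstein_pow_le_diam {ℓ : ℕ} (hℓ : 1 ≤ ℓ) {G H : Θ →₀ ℝ} (hG : IsMixing G)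
    (hH : IsMixing H) {D : ℝ} (hD : ∀ θ η : Θ, ‖(θ : Param q) - η‖ ≤ D) :
    wasserstein ℓ G H ^ ℓ ≤ D ^ ℓ := by
  refine (wasserstein_pow_le hℓ (isCoupling_mul hG hH)).trans ?_
  calc couplingCost ℓ G H (fun θ η => G θ * H η)
      ≤ ∑ θ ∈ G.support, ∑ η ∈ H.support, G θ * H η * D ^ ℓ := by
        unfold couplingCost
        gcongr with θ _ η _
        · exact mul_nonneg (hG.1 θ) (hH.1 η)
        · exact hD θ η
    _ = D ^ ℓ := by
        simp only [← Finset.sum_mul, ← Finset.mul_sum, hH.2, hG.2, one_mul, mul_one]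

open Classical in
/-- The mass that `G` gives to a set. -/
noncomputable def mass (G : Θ →₀ ℝ) (A : Set Θ) : ℝ :=
  ∑ θ ∈ G.support with θ ∈ A, G θ

/-- Mass in `A` that has to leave the `ε`-neighbourhood of `A` costs at least `ε ^ ℓ`. -/
theorem mass_sub_mul_pow_le {ℓ : ℕ} (hℓ : 1 ≤ ℓ) {G H : Θ →₀ ℝ} (hG : IsMixing G)
    (hH : IsMixing H) {A A' : Set Θ} {ε : ℝ} (hε : 0 ≤ ε)
    (hA : ∀ θ ∈ A, ∀ η, η ∉ A' → ε ≤ ‖(θ : Param q) - η‖) :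
    (mass G A - mass H A') * ε ^ ℓ ≤ wasserstein ℓ G H ^ ℓ := by
  classical
  rw [wasserstein_pow hℓ]
  refine le_csInf ⟨_, _, isCoupling_mul hG hH, rfl⟩ ?_
  rintro _ ⟨Q, hQ, rfl⟩
  have h1 : mass G A =
      ∑ θ ∈ G.support with θ ∈ A, ∑ η ∈ H.support with η ∈ A', Q θ η +
      ∑ θ ∈ G.support with θ ∈ A, ∑ η ∈ H.support with η ∉ A', Q θ η := by
    rw [mass, ← Finset.sum_add_distrib]
    refine Finset.sum_congr rfl fun θ hθ => ?_
    rw [Finset.sum_filter_add_sum_filter_not, hQ.2.1 θ (Finset.mem_filter.1 hθ).1]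
  have h2 : ∑ θ ∈ G.support with θ ∈ A, ∑ η ∈ H.support with η ∈ A', Q θ η ≤
      mass H A' := by
    rw [mass, Finset.sum_comm]
    refine Finset.sum_le_sum fun η hη => ?_
    have hη' := (Finset.mem_filter.1 hη).1
    rw [← hQ.2.2 η hη']
    exact Finset.sum_le_sum_of_subset_of_nonneg (Finset.filter_subset _ _)
      fun θ hθ _ => hQ.1 θ hθ η hη'
  calc _ ≤ (∑ θ ∈ G.support with θ ∈ A, ∑ η ∈ H.support with η ∉ A', Q θ η) * ε ^ ℓ := by
        gcongr; linarith
    _ ≤ ∑ θ ∈ G.support with θ ∈ A, ∑ η ∈ H.support with η ∉ A',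
          Q θ η * ‖(θ : Param q) - η‖ ^ ℓ := by
        simp only [Finset.sum_mul]
        refine Finset.sum_le_sum fun θ hθ => Finset.sum_le_sum fun η hη => ?_
        rw [Finset.mem_filter] at hθ hη
        have := hA θ hθ.2 η hη.2
        exact mul_le_mul_of_nonneg_left (by gcongr) (hQ.1 θ hθ.1 η hη.1)
    _ ≤ couplingCost ℓ G H Q := by
        unfold couplingCost
        refine (Finset.sum_le_sum fun θ hθ => ?_).trans
          (Finset.sum_le_sum_of_subset_of_nonneg (Finset.filter_subset _ _) fun θ hθ _ =>
            Finset.sum_nonneg fun η hη => mul_nonneg (hQ.1 θ hθ η hη) (by positivity))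
        exact Finset.sum_le_sum_of_subset_of_nonneg (Finset.filter_subset _ _) fun η hη _ =>
          mul_nonneg (hQ.1 θ (Finset.mem_filter.1 hθ).1 η hη) (by positivity)

/-! ### Comparison of Wasserstein distances and moments -/

/-- Sorts the atoms by their projection. The values of `z` from `S.card` on are arbitrary. -/
theorem exists_enumeration {ι : Type*} [Nonempty ι] (S : Finset ι) (φ : ι → ℝ)
    (hφ : Set.InjOn φ S) :
    ∃ z : ℕ → ι, (∀ i j, i < j → j < S.card → φ (z i) < φ (z j)) ∧
      (∀ l < S.card, z l ∈ S) ∧ ∀ s ∈ S, ∃ l < S.card, z l = s := by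
  classical
  have hcard : (S.image φ).card = S.card := Finset.card_image_of_injOn hφ
  set e := (S.image φ).orderEmbOfFin hcard
  have he : ∀ i, ∃ s ∈ S, φ s = e i := fun i =>
    Finset.mem_image.1 (Finset.orderEmbOfFin_mem (S.image φ) hcard i)
  choose y hyS hy using he
  refine ⟨fun l => if h : l < S.card then y ⟨l, h⟩ else Classical.arbitrary ι,
    fun i j hij hj => ?_, fun l hl => by simp [hl, hyS], fun s hs => ?_⟩
  · simp only [hj, hij.trans hj, dif_pos, hy]
    exact e.strictMono hij
  · have : φ s ∈ Set.range e := by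
      rw [Finset.range_orderEmbOfFin]; exact Finset.mem_coe.2 (Finset.mem_image_of_mem φ hs)
    obtain ⟨i, hi⟩ := this
    exact ⟨i, i.2, by simpa using hφ (hyS i) hs ((hy i).trans hi)⟩

theorem norm_le_sum_abs (v : Param q) : ‖v‖ ≤ ∑ i, |v i| := by
  rw [EuclideanSpace.norm_eq]
  refine Real.sqrt_le_iff.2 ⟨Finset.sum_nonneg fun _ _ => abs_nonneg _, ?_⟩
  simp only [Real.norm_eq_abs]
  exact Finset.sum_sq_le_sq_sum_of_nonneg fun _ _ => abs_nonneg _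

theorem abs_apply_le_norm (v : Param q) (i : Fin q) : |v i| ≤ ‖v‖ := by
  simpa using PiLp.norm_apply_le v i

theorem sum_support_eq {G : Θ →₀ ℝ} {S : Finset Θ} (hS : G.support ⊆ S) (f : Θ → ℝ) :
    ∑ θ ∈ G.support, G θ * f θ = ∑ θ ∈ S, G θ * f θ :=
  Finset.sum_subset hS fun θ _ h => by rw [Finsupp.notMem_support_iff.1 h, zero_mul]

/-- If at most `ℓ + 1` of the atoms of `G` and `H` can lie close together, then `W_ℓ ^ ℓ` is
bounded by the differences of the moments. -/
theorem exists_wasserstein_pow_le {θ₀ : Param q} {R : ℝ}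
    (hR : ∀ θ ∈ Θ, ‖θ - θ₀‖ ≤ R) (k : ℕ) (hk : 1 ≤ k) {ℓ : ℕ} (hℓ : 1 ≤ ℓ) {ρ : ℝ} (hρ : 0 < ρ) :
    ∃ C : ℝ, 0 < C ∧ ∀ G ∈ atMostAtoms Θ k, ∀ H ∈ atMostAtoms Θ k,
      (∀ B : Finset Θ, (∀ θ ∈ B, G θ ≠ 0 ∨ H θ ≠ 0) →
        (∀ θ ∈ B, ∀ η ∈ B, ‖(θ : Param q) - η‖ ≤ ρ) → B.card ≤ ℓ + 1) →
      ∀ δ : ℝ, (∀ α : MultiIndex q (2 * k - 1),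
        |centeredMoment θ₀ α.1 G - centeredMoment θ₀ α.1 H| ≤ δ) →
      wasserstein ℓ G H ^ ℓ ≤ C * δ := by
  classical
  -- The vectors to be seen are the differences of ordered pairs among at most `2k` atoms.
  obtain ⟨c, hc, hdir⟩ := exists_direction ((2 * k) * (2 * k)) (Finset.univ : Finset (Fin q))
  obtain ⟨p, rfl⟩ : ∃ p, ℓ = p + 1 := ⟨ℓ - 1, by omega⟩
  set N : ℕ := (2 * k) * (2 * k)
  set L : ℝ := q * N * (1 + |R|) with hLdef
  have hL0 : 0 ≤ L := by positivity
  set K : ℝ := (max 1 (2 * L / (c * ρ))) ^ (2 * k - 1) * (2 * L + c * ρ) ^ (p + 1) with hK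
  have hK0 : 0 < K := by positivity
  -- The factors are the number of terms, the power-mean loss in splitting a distance into gaps, the
  -- projection loss, and the bound `K` at one gap.
  refine ⟨(2 * k : ℕ) * (((2 * k : ℕ) : ℝ) ^ p / c ^ (p + 1) * K), by positivity, ?_⟩
  rintro G ⟨hG, hGk⟩ H ⟨hH, hHk⟩ hB δ hδ
  have hδ0 : 0 ≤ δ := (abs_nonneg _).trans (hδ ⟨0, by simp⟩)
  set S := G.support ∪ H.support with hS
  have hSG : G.support ⊆ S := Finset.subset_union_left
  have hSH : H.support ⊆ S := Finset.subset_union_right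
  have hSk : S.card ≤ 2 * k := (Finset.card_union_le _ _).trans (by omega)
  obtain ⟨u, hu, hT⟩ := hdir
    ((S ×ˢ S).image fun t => fun i => (t.1 : Param q) i - (t.2 : Param q) i) (by
      refine Finset.card_image_le.trans ?_
      rw [Finset.card_product]
      exact Nat.mul_le_mul hSk hSk)
  set φ : Θ → ℝ := fun θ => ∑ i, u i * ((θ : Param q) i - θ₀ i) with hφ
  have hsep : ∀ θ ∈ S, ∀ η ∈ S, c * ‖(θ : Param q) - η‖ ≤ |φ θ - φ η| := by
    intro θ hθ η hη
    have h1 := hT _ (Finset.mem_image_of_mem _ (Finset.mk_mem_product hθ hη))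
    have h2 : φ θ - φ η = ∑ i, u i * ((θ : Param q) i - (η : Param q) i) := by
      rw [hφ, ← Finset.sum_sub_distrib]; exact Finset.sum_congr rfl fun i _ => by ring
    rw [h2]
    refine le_trans ?_ h1
    have := norm_le_sum_abs ((θ : Param q) - (η : Param q))
    simp only [PiLp.sub_apply] at this
    gcongr
  have hφinj : Set.InjOn φ S := by
    intro θ hθ η hη h
    have := hsep θ hθ η hη
    rw [h, sub_self, abs_zero] at this
    have h0 : ‖(θ : Param q) - η‖ ≤ 0 := by
      by_contra hcon
      push Not at hcon
      have := mul_pos hc hcon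
      linarith
    exact Subtype.ext (sub_eq_zero.1 (norm_le_zero_iff.1 h0))
  have hSne : Nonempty Θ := by
    by_contra hcon
    rw [not_nonempty_iff] at hcon
    have := hG.2
    rw [Subsingleton.elim G 0] at this
    simp at this
  obtain ⟨z, hz, hzS, hzsurj⟩ := exists_enumeration S φ hφinj
  set m := S.card with hm
  set x : ℕ → ℝ := fun l => φ (z l) with hxdef
  have hxmono : ∀ i j, i ≤ j → j < m → x i ≤ x j := fun i j hij hj =>
    hij.eq_or_lt.elim (fun h => h ▸ le_rfl) fun h => (hz i j h hj).le
  have hzinj : ∀ i < m, ∀ j < m, z i = z j → i = j := by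
    intro i hi j hj h
    by_contra hne
    rcases lt_or_gt_of_ne hne with h' | h'
    · exact absurd (hz i j h' hj) (by rw [h]; exact lt_irrefl _)
    · exact absurd (hz j i h' hi) (by rw [h]; exact lt_irrefl _)
  have hsum : ∀ f : Θ → ℝ, ∑ θ ∈ S, f θ = ∑ l ∈ Finset.range m, f (z l) := by
    intro f
    symm
    refine Finset.sum_bij (fun l _ => z l) (fun l hl => hzS l (Finset.mem_range.1 hl))
      (fun i hi j hj h => hzinj i (Finset.mem_range.1 hi) j (Finset.mem_range.1 hj) h)
      (fun s hs => ?_) (fun _ _ => rfl)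
    obtain ⟨l, hl, h⟩ := hzsurj s hs
    exact ⟨l, Finset.mem_range.2 hl, h⟩
  -- cumulative functions
  set F : ℕ → ℝ := fun a => ∑ l ∈ Finset.range a, G (z l) with hF
  set F' : ℕ → ℝ := fun a => ∑ l ∈ Finset.range a, H (z l) with hF'
  have hFmono : Monotone F := monotone_nat_of_le_succ fun n => by
    simp only [hF, Finset.sum_range_succ]; linarith [hG.1 (z n)]
  have hFmono' : Monotone F' := monotone_nat_of_le_succ fun n => by
    simp only [hF', Finset.sum_range_succ]; linarith [hH.1 (z n)]
  have hFm : F m = 1 := by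
    have := sum_support_eq hSG (fun _ => 1)
    simp only [mul_one] at this
    rw [hF, ← hG.2, this, hsum]
  have hFm' : F' m = 1 := by
    have := sum_support_eq hSH (fun _ => 1)
    simp only [mul_one] at this
    rw [hF', ← hH.2, this, hsum]
  -- bounds at the gaps
  have hgap : ∀ a, a + 1 < m → (x (a + 1) - x a) ^ (p + 1) * |F (a + 1) - F' (a + 1)| ≤ K * δ := by
    intro a ha
    have := gap_pow_mul_abs_sum_le (q := q) (m := m) (ζ := fun l i => (z l : Param q) i - θ₀ i)
      (u := u) (x := x) (fun l => rfl) hz (L := L) (ρ := c * ρ) (ℓ := p + 1) (n := 2 * k - 1)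
      ?_ hL0 (by positivity) ?_ (by omega) (w := fun l => G (z l) - H (z l)) (δ := δ) ?_ ha
    · simpa only [Finset.sum_sub_distrib] using this
    · intro l hl
      have h1 : ∑ i, |u i| ≤ q * N := by
        refine (Finset.sum_le_sum fun i _ => hu i).trans ?_
        simp
      have h2 : |x l| ≤ q * N * |R| := by
        refine (Finset.abs_sum_le_sum_abs _ _).trans ?_
        have : ∀ i ∈ Finset.univ, |u i * ((z l : Param q) i - θ₀ i)| ≤ N * |R| := by
          intro i _
          rw [abs_mul]
          refine mul_le_mul (hu i) ?_ (abs_nonneg _) (Nat.cast_nonneg _)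
          have h3 := abs_apply_le_norm ((z l : Param q) - θ₀) i
          rw [PiLp.sub_apply] at h3
          exact h3.trans ((hR _ (z l).2).trans (le_abs_self R))
        refine (Finset.sum_le_sum this).trans ?_
        simp [mul_assoc]
      rw [hLdef]; linarith
    -- At least `ℓ + 2` consecutive points with projected spread below `c * ρ` would form a cluster
    -- of diameter at most `ρ`, contrary to `hB`.
    · intro i j hij hj
      by_contra hcon
      push Not at hcon
      have hIcc : ∀ l ∈ Finset.Icc i j, l < m := fun l hl => by
        rw [Finset.mem_Icc] at hl; omega
      have := hB ((Finset.Icc i j).image z) ?_ ?_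
      · rw [Finset.card_image_of_injOn fun a ha b hb h =>
          hzinj a (hIcc a ha) b (hIcc b hb) h, Nat.card_Icc] at this
        omega
      · intro θ hθ
        obtain ⟨l, hl, rfl⟩ := Finset.mem_image.1 hθ
        have := hzS l (hIcc l hl)
        simpa [hS] using this
      · intro θ hθ η hη
        obtain ⟨l, hl, rfl⟩ := Finset.mem_image.1 hθ
        obtain ⟨l', hl', rfl⟩ := Finset.mem_image.1 hη
        have h1 := hsep _ (hzS l (hIcc l hl)) _ (hzS l' (hIcc l' hl'))
        have h2 := hIcc l hl
        have h3 := hIcc l' hl'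
        rw [Finset.mem_Icc] at hl hl'
        have h4 : |x l - x l'| ≤ x j - x i := by
          have := hxmono i l hl.1 h2
          have := hxmono l j hl.2 hj
          have := hxmono i l' hl'.1 h3
          have := hxmono l' j hl'.2 hj
          rw [abs_le]; constructor <;> linarith
        exact le_of_mul_le_mul_left ((h1.trans h4).trans hcon.le) hc
    · intro α hα
      refine le_trans (le_of_eq ?_) (hδ ⟨α, hα⟩)
      simp only [centeredMoment]
      rw [sum_support_eq hSG, sum_support_eq hSH, hsum, hsum, ← Finset.sum_sub_distrib]
      congr 1
      exact Finset.sum_congr rfl fun l _ => by ring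
  -- the coupling
  have hidx : ∀ θ, ∃ l, θ ∈ S → l < m ∧ z l = θ := by
    intro θ
    by_cases h : θ ∈ S
    · obtain ⟨l, h1, h2⟩ := hzsurj θ h
      exact ⟨l, fun _ => ⟨h1, h2⟩⟩
    · exact ⟨0, fun h' => absurd h' h⟩
  choose idx hidx using hidx
  have hidxz : ∀ l < m, idx (z l) = l := fun l hl =>
    hzinj _ (hidx _ (hzS l hl)).1 l hl (hidx _ (hzS l hl)).2
  have hcoup : IsCoupling G H (fun θ η => comonotone F F' (idx θ) (idx η)) := by
    refine ⟨fun θ _ η _ => comonotone_nonneg hFmono hFmono' _ _, fun θ hθ => ?_, fun η hη => ?_⟩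
    · have h5 : ∑ η ∈ S, comonotone F F' (idx θ) (idx η) =
          ∑ j ∈ Finset.range m, comonotone F F' (idx θ) j := by
        rw [hsum]
        exact Finset.sum_congr rfl fun l hl => by rw [hidxz l (Finset.mem_range.1 hl)]
      rw [Finset.sum_subset hSH (fun η hη hη' => ?_)]
      · rw [h5, Finset.range_eq_Ico, sum_comonotone_right _ _ _ (Nat.zero_le m)]
        obtain ⟨h1, h2⟩ := hidx θ (hSG hθ)
        rw [hFm', min_eq_left (hFm ▸ hFmono h1), min_eq_left (hFm ▸ hFmono h1.le)]
        have h3 : ∀ n, 0 ≤ F n := fun n => Finset.sum_nonneg fun _ _ => hG.1 _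
        have h4 : F' 0 = 0 := by simp [hF']
        rw [h4, min_eq_right (h3 _), min_eq_right (h3 _)]
        simp [hF, Finset.sum_range_succ, h2]
      · obtain ⟨h1, h2⟩ := hidx η hη
        have : F' (idx η + 1) = F' (idx η) := by
          simp only [hF', Finset.sum_range_succ, h2, Finsupp.notMem_support_iff.1 hη', add_zero]
        simp [comonotone, this]
    · have h5 : ∑ θ ∈ S, comonotone F F' (idx θ) (idx η) =
          ∑ j ∈ Finset.range m, comonotone F' F (idx η) j := by
        rw [hsum]
        exact Finset.sum_congr rfl fun l hl => by
          rw [hidxz l (Finset.mem_range.1 hl), comonotone_swap]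
      rw [Finset.sum_subset hSG (fun θ hθ hθ' => ?_)]
      · rw [h5, Finset.range_eq_Ico, sum_comonotone_right _ _ _ (Nat.zero_le m)]
        obtain ⟨h1, h2⟩ := hidx η (hSH hη)
        rw [hFm, min_eq_left (hFm' ▸ hFmono' h1), min_eq_left (hFm' ▸ hFmono' h1.le)]
        have h3 : ∀ n, 0 ≤ F' n := fun n => Finset.sum_nonneg fun _ _ => hH.1 _
        have h4 : F 0 = 0 := by simp [hF]
        rw [h4, min_eq_right (h3 _), min_eq_right (h3 _)]
        simp [hF', Finset.sum_range_succ, h2]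
      · obtain ⟨h1, h2⟩ := hidx θ hθ
        have : F (idx θ + 1) = F (idx θ) := by
          simp only [hF, Finset.sum_range_succ, h2, Finsupp.notMem_support_iff.1 hθ', add_zero]
        simp [comonotone, this]
  refine (wasserstein_pow_le hℓ hcoup).trans ?_
  set γ : ℕ → ℝ := fun a => ((2 * k : ℕ) : ℝ) ^ p / c ^ (p + 1) * (x (a + 1) - x a) ^ (p + 1)
    with hγ
  calc couplingCost (p + 1) G H (fun θ η => comonotone F F' (idx θ) (idx η))
      ≤ ∑ θ ∈ S, ∑ η ∈ S, comonotone F F' (idx θ) (idx η) * ‖(θ : Param q) - η‖ ^ (p + 1) := by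
        unfold couplingCost
        have h0 : ∀ θ η : Θ, 0 ≤ comonotone F F' (idx θ) (idx η) *
            ‖(θ : Param q) - η‖ ^ (p + 1) := fun θ η =>
          mul_nonneg (comonotone_nonneg hFmono hFmono' _ _) (by positivity)
        refine (Finset.sum_le_sum fun θ hθ => ?_).trans
          (Finset.sum_le_sum_of_subset_of_nonneg hSG fun θ hθ _ =>
            Finset.sum_nonneg fun η hη => h0 θ η)
        exact Finset.sum_le_sum_of_subset_of_nonneg hSH fun η hη _ => h0 θ η
    _ = ∑ i ∈ Finset.range m, ∑ j ∈ Finset.range m,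
          comonotone F F' i j * ‖(z i : Param q) - z j‖ ^ (p + 1) := by
        rw [hsum]
        refine Finset.sum_congr rfl fun i hi => ?_
        rw [hsum]
        refine Finset.sum_congr rfl fun j hj => ?_
        rw [hidxz i (Finset.mem_range.1 hi), hidxz j (Finset.mem_range.1 hj)]
    _ ≤ ∑ a ∈ Finset.range m, γ a * |F (a + 1) - F' (a + 1)| := by
        refine comonotone_cost_le hFmono hFmono' (by simp [hF]) (by simp [hF'])
          (hFm.trans hFm'.symm) (fun i j => ‖(z i : Param q) - z j‖ ^ (p + 1)) γ ?_
          (fun i j => by rw [norm_sub_rev])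
        intro i j hij hj
        have h1 := hsep _ (hzS j hj) _ (hzS i (by omega))
        have h2 : 0 ≤ x j - x i := sub_nonneg.2 (hxmono i j hij hj)
        change _ ≤ |x j - x i| at h1
        rw [abs_of_nonneg h2] at h1
        -- The power-mean inequality splits `(x j - x i) ^ (p + 1)` over the gaps in between.
        have h3 := pow_sum_div_card_le_sum_pow (s := Finset.Ico i j)
          (f := fun a => x (a + 1) - x a) (fun a ha => by
            rw [Finset.mem_Ico] at ha
            exact sub_nonneg.2 (hxmono _ _ (Nat.le_succ a) (by omega))) p
        rw [Finset.sum_Ico_sub x hij, Nat.card_Ico] at h3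
        have hsn : 0 ≤ ∑ a ∈ Finset.Ico i j, (x (a + 1) - x a) ^ (p + 1) :=
          Finset.sum_nonneg fun a ha => by
            rw [Finset.mem_Ico] at ha
            have := sub_nonneg.2 (hxmono _ _ (Nat.le_succ a) (by omega))
            positivity
        have h4 : (x j - x i) ^ (p + 1) ≤ ((2 * k : ℕ) : ℝ) ^ p *
            ∑ a ∈ Finset.Ico i j, (x (a + 1) - x a) ^ (p + 1) := by
          rcases hij.eq_or_lt with rfl | hlt
          · simp
          have hpos : (0 : ℝ) < ((j - i : ℕ) : ℝ) := by
            exact_mod_cast Nat.sub_pos_of_lt hlt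
          rw [div_le_iff₀ (by positivity)] at h3
          refine h3.trans ?_
          rw [mul_comm]
          gcongr
          omega
        have h5 : ‖(z i : Param q) - z j‖ ^ (p + 1) * c ^ (p + 1) ≤ (x j - x i) ^ (p + 1) := by
          rw [← mul_pow, norm_sub_rev, mul_comm]
          gcongr
        rw [hγ, ← Finset.mul_sum, div_mul_eq_mul_div, le_div_iff₀ (by positivity)]
        exact h5.trans h4
    _ ≤ ∑ a ∈ Finset.range m, ((2 * k : ℕ) : ℝ) ^ p / c ^ (p + 1) * (K * δ) := by
        refine Finset.sum_le_sum fun a ha => ?_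
        rw [Finset.mem_range] at ha
        by_cases ha' : a + 1 < m
        · rw [hγ, mul_assoc]
          exact mul_le_mul_of_nonneg_left (hgap a ha') (by positivity)
        -- There is no gap after the last point; both cumulative functions equal `1` there, so the
        -- junk value `x m` is harmless.
        · have h : a + 1 = m := by omega
          rw [h, hFm, hFm', sub_self, abs_zero, mul_zero]
          positivity
    _ ≤ _ := by
        rw [Finset.sum_const, Finset.card_range, nsmul_eq_mul, ← mul_assoc _ K δ, ← mul_assoc _ _ δ]
        gcongr

end MixtureGMM

/-! ### Global and local moment comparison -/

namespace MixtureGMM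

variable {q : ℕ} {Θ : Set (Param q)}

/-- With `ℓ + 1 = 2k` the cluster condition only counts all atoms, so the radius `1` is arbitrary.
-/
theorem exists_wasserstein_pow_le_global {θ₀ : Param q} {R : ℝ} (hR : ∀ θ ∈ Θ, ‖θ - θ₀‖ ≤ R)
    {k : ℕ} (hk : 1 ≤ k) :
    ∃ C : ℝ, 0 < C ∧ ∀ G ∈ atMostAtoms Θ k, ∀ H ∈ atMostAtoms Θ k,
      ∀ δ : ℝ, (∀ α : MultiIndex q (2 * k - 1),
        |centeredMoment θ₀ α.1 G - centeredMoment θ₀ α.1 H| ≤ δ) →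
      wasserstein (2 * k - 1) G H ^ (2 * k - 1) ≤ C * δ := by
  classical
  obtain ⟨C, hC, h⟩ := exists_wasserstein_pow_le hR k hk (ℓ := 2 * k - 1) (by omega) one_pos
  refine ⟨C, hC, fun G hG H hH δ hδ => h G hG H hH (fun B hB _ => ?_) δ hδ⟩
  have hsub : B ⊆ G.support ∪ H.support := fun θ hθ => by simpa using hB θ hθ
  have := (Finset.card_le_card hsub).trans (Finset.card_union_le _ _)
  have := hG.2
  have := hH.2
  omega

theorem exists_pos_forall_le {ι : Type*} (S : Finset ι) (f : ι → ℝ) (hf : ∀ s ∈ S, 0 < f s) :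
    ∃ σ : ℝ, 0 < σ ∧ ∀ s ∈ S, σ ≤ f s := by
  rcases S.eq_empty_or_nonempty with rfl | hS
  · exact ⟨1, one_pos, by simp⟩
  · obtain ⟨s, hs, h⟩ := S.exists_min_image f hS
    exact ⟨f s, hf s hs, h⟩

/-- A small set of atoms misses the atoms close to all but one of several separated points. -/
theorem card_add_card_le {S₀ S B : Finset Θ} {ε : ℝ}
    (hsep : ∀ θ ∈ S₀, ∀ η ∈ S₀, θ ≠ η → 5 * ε ≤ ‖(θ : Param q) - η‖)
    (hnear : ∀ θ ∈ S₀, ∃ η ∈ S, ‖(η : Param q) - θ‖ < 2 * ε) (hBS : B ⊆ S)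
    (hB : ∀ θ ∈ B, ∀ η ∈ B, ‖(θ : Param q) - η‖ ≤ ε) : B.card + S₀.card ≤ S.card + 1 := by
  classical
  have : ∀ θ, ∃ η, θ ∈ S₀ → η ∈ S ∧ ‖(η : Param q) - θ‖ < 2 * ε := fun θ => by
    by_cases h : θ ∈ S₀
    · obtain ⟨η, h1, h2⟩ := hnear θ h
      exact ⟨η, fun _ => ⟨h1, h2⟩⟩
    · exact ⟨θ, fun h' => absurd h' h⟩
  choose a ha using this
  have hdist : ∀ θ η b b' : Θ, ‖(b : Param q) - θ‖ < 2 * ε → ‖(b' : Param q) - η‖ < 2 * ε →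
      ‖(b : Param q) - b'‖ ≤ ε → ‖(θ : Param q) - η‖ < 5 * ε := by
    intro θ η b b' h1 h2 h3
    have e : (θ : Param q) - η = ((b : Param q) - b') - ((b : Param q) - θ) + ((b' : Param q) - η) := by
      abel
    have := norm_add_le (((b : Param q) - b') - ((b : Param q) - θ)) ((b' : Param q) - η)
    have := norm_sub_le ((b : Param q) - b') ((b : Param q) - θ)
    rw [e]; linarith
  -- By the `5 ε` separation `B` approaches at most one point of `S₀`; all the others own distinct
  -- atoms of `S` outside `B`.
  set S₁ := S₀.filter fun θ : Θ => ∀ b ∈ B, 2 * ε ≤ ‖(b : Param q) - θ‖ with hS₁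
  have hcard : S₀.card ≤ S₁.card + 1 := by
    have h1 : S₁.card + (S₀.filter fun θ : Θ => ¬ ∀ b ∈ B, 2 * ε ≤ ‖(b : Param q) - θ‖).card =
        S₀.card := by
      rw [hS₁]; convert Finset.card_filter_add_card_filter_not _
    have h2 : (S₀.filter fun θ : Θ => ¬ ∀ b ∈ B, 2 * ε ≤ ‖(b : Param q) - θ‖).card ≤ 1 := by
      refine Finset.card_le_one.2 fun θ hθ η hη => ?_
      rw [Finset.mem_filter] at hθ hη
      obtain ⟨hθ, hb⟩ := hθ
      obtain ⟨hη, hb'⟩ := hη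
      push Not at hb hb'
      obtain ⟨b, hbB, hb⟩ := hb
      obtain ⟨b', hbB', hb'⟩ := hb'
      by_contra hne
      exact absurd (hsep θ hθ η hη hne) (not_le.2 (hdist θ η b b' hb hb' (hB b hbB b' hbB')))
    omega
  have hinj : Set.InjOn a S₁ := by
    intro θ hθ η hη h
    have hθ' := ha θ (Finset.mem_filter.1 hθ).1
    have hη' := ha η (Finset.mem_filter.1 hη).1
    by_contra hne
    refine absurd (hsep θ (Finset.mem_filter.1 hθ).1 η (Finset.mem_filter.1 hη).1 hne)
      (not_le.2 (hdist θ η (a θ) (a η) hθ'.2 hη'.2 ?_))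
    rw [h, sub_self, norm_zero]
    linarith [norm_nonneg ((a θ : Param q) - θ)]
  have hdisj : Disjoint B (S₁.image a) := by
    rw [Finset.disjoint_left]
    intro b hb hb'
    obtain ⟨θ, hθ, rfl⟩ := Finset.mem_image.1 hb'
    obtain ⟨hθ, h⟩ := Finset.mem_filter.1 hθ
    exact absurd (h _ hb) (not_le.2 (ha θ hθ).2)
  have hsub : B ∪ S₁.image a ⊆ S := by
    refine Finset.union_subset hBS fun η hη => ?_
    obtain ⟨θ, hθ, rfl⟩ := Finset.mem_image.1 hη
    exact (ha θ (Finset.mem_filter.1 hθ).1).1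
  have := Finset.card_le_card hsub
  rw [Finset.card_union_of_disjoint hdisj, Finset.card_image_of_injOn hinj] at this
  omega

/-- For large `δ` the diameter bound suffices. For small `δ` the global bound forces `H` as well as
`G` to keep mass near each atom of `G₀`, which limits the clusters. -/
theorem exists_wasserstein_pow_le_local {θ₀ : Param q} {R : ℝ} (hR : ∀ θ ∈ Θ, ‖θ - θ₀‖ ≤ R)
    {k k₀ d : ℕ} (hk₀ : 1 ≤ k₀) (hk : k₀ ≤ k) (hd : d = k - k₀ + 1) {G₀ : Θ →₀ ℝ}
    (hG₀ : G₀ ∈ exactAtoms Θ k₀) :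
    ∃ r C : ℝ, 0 < r ∧ 0 < C ∧ ∀ G ∈ atMostAtoms Θ k, ∀ H ∈ atMostAtoms Θ k,
      wasserstein 1 G₀ G < r →
      ∀ δ : ℝ, (∀ α : MultiIndex q (2 * k - 1),
        |centeredMoment θ₀ α.1 G - centeredMoment θ₀ α.1 H| ≤ δ) →
      wasserstein (2 * d - 1) G H ^ (2 * d - 1) ≤ C * δ ∧
      wasserstein (2 * d - 1) H G ^ (2 * d - 1) ≤ C * δ := by
  classical
  obtain ⟨hG₀, hcard⟩ := hG₀
  obtain ⟨σ, hσ, hsep⟩ := exists_pos_forall_le G₀.support.offDiag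
    (fun t => ‖(t.1 : Param q) - t.2‖) (fun t ht => by
      rw [Finset.mem_offDiag] at ht
      exact norm_pos_iff.2 (sub_ne_zero.2 fun h => ht.2.2 (Subtype.ext h)))
  obtain ⟨p, hp, hweight⟩ := exists_pos_forall_le G₀.support G₀ (fun θ hθ =>
    lt_of_le_of_ne (hG₀.1 θ) (Ne.symm (Finsupp.mem_support_iff.1 hθ)))
  set ε := σ / 5 with hεdef
  have hε : 0 < ε := by positivity
  have hsep' : ∀ θ ∈ G₀.support, ∀ η ∈ G₀.support, θ ≠ η → 5 * ε ≤ ‖(θ : Param q) - η‖ := by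
    intro θ hθ η hη hne
    have := hsep (θ, η) (Finset.mem_offDiag.2 ⟨hθ, hη, hne⟩)
    rw [hεdef]; simpa [mul_div_cancel₀] using this
  obtain ⟨C₁, hC₁, hglob⟩ := exists_wasserstein_pow_le_global hR (hk₀.trans hk)
  obtain ⟨C₂, hC₂, hloc⟩ := exists_wasserstein_pow_le hR k (hk₀.trans hk) (ℓ := 2 * d - 1)
    (by omega) hε
  -- Below `δ₁` the global bound lets less than `p / 4` of mass move by `ε` or more between `G` and
  -- `H`; the radius `p / 4 * ε` does the same for `G₀` and `G` through `W₁`.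
  set δ₁ := p / 4 * ε ^ (2 * k - 1) / C₁ with hδ₁
  have hδ₁0 : 0 < δ₁ := by positivity
  refine ⟨p / 4 * ε, C₂ + (2 * |R|) ^ (2 * d - 1) / δ₁, by positivity, by positivity,
    fun G hG H hH hr δ hδ => ?_⟩
  have hδ0 : 0 ≤ δ := (abs_nonneg _).trans (hδ ⟨0, by simp⟩)
  rcases le_or_gt δ₁ δ with hbig | hsmall
  · have hdiam : ∀ θ η : Θ, ‖(θ : Param q) - η‖ ≤ 2 * |R| := by
      intro θ η
      have e : (θ : Param q) - η = (θ - θ₀) - (η - θ₀) := by abel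
      have := norm_sub_le ((θ : Param q) - θ₀) (η - θ₀)
      have := hR θ θ.2
      have := hR η η.2
      have := le_abs_self R
      rw [e]; linarith
    have hb : (2 * |R|) ^ (2 * d - 1) ≤ (C₂ + (2 * |R|) ^ (2 * d - 1) / δ₁) * δ := by
      have h1 : (2 * |R|) ^ (2 * d - 1) ≤ (2 * |R|) ^ (2 * d - 1) / δ₁ * δ := by
        rw [div_mul_eq_mul_div, le_div_iff₀ hδ₁0]; gcongr
      have h2 : 0 ≤ C₂ * δ := by positivity
      rw [add_mul]; linarith
    exact ⟨(wasserstein_pow_le_diam (by omega) hG.1 hH.1 hdiam).trans hb,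
      (wasserstein_pow_le_diam (by omega) hH.1 hG.1 hdiam).trans hb⟩
  -- every atom of `G₀` has mass of `G` and of `H` close to it
  have hmassG : ∀ θ ∈ G₀.support,
      3 * p / 4 < mass G {η : Θ | ‖(η : Param q) - θ‖ < ε} := by
    intro θ hθ
    have h1 := mass_sub_mul_pow_le le_rfl hG₀ hG.1 (A := {θ})
      (A' := {η : Θ | ‖(η : Param q) - θ‖ < ε}) hε.le (by
        rintro _ rfl η hη
        rw [norm_sub_rev]; exact not_lt.1 hη)
    rw [pow_one, pow_one] at h1
    have h2 := lt_of_mul_lt_mul_right (h1.trans_lt hr) hε.le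
    have h3 : mass G₀ {θ} = G₀ θ := by
      rw [mass, Finset.sum_filter, Finset.sum_eq_single θ]
      · simp
      · intro η _ h; simp [h]
      · exact fun h => absurd hθ h
    have h4 := hweight θ hθ
    rw [h3] at h2
    linarith
  have hmassH : ∀ θ ∈ G₀.support,
      0 < mass H {η : Θ | ‖(η : Param q) - θ‖ < 2 * ε} := by
    intro θ hθ
    have h1 := mass_sub_mul_pow_le (ℓ := 2 * k - 1) (by omega) hG.1 hH.1
      (A := {η : Θ | ‖(η : Param q) - θ‖ < ε})
      (A' := {η : Θ | ‖(η : Param q) - θ‖ < 2 * ε}) hε.le (by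
        intro η hη η' hη'
        simp only [Set.mem_ofPred_eq, not_lt] at hη hη'
        have e : (η' : Param q) - θ = (η - θ) - (η - η') := by abel
        have := norm_sub_le ((η : Param q) - θ) (η - η')
        rw [← e] at this
        linarith)
    have h2 : C₁ * δ < p / 4 * ε ^ (2 * k - 1) := by
      rw [hδ₁, lt_div_iff₀ hC₁] at hsmall; linarith
    have h3 := lt_of_mul_lt_mul_right ((h1.trans (hglob G hG H hH δ hδ)).trans_lt h2)
      (by positivity)
    have h4 := hmassG θ hθ
    linarith
  have hnear : ∀ (K : Θ →₀ ℝ) (t : ℝ), t ≤ 2 * ε → ∀ θ : Θ,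
      0 < mass K {η : Θ | ‖(η : Param q) - θ‖ < t} →
      ∃ η ∈ K.support, ‖(η : Param q) - θ‖ < 2 * ε := by
    intro K t ht θ h
    obtain ⟨η, hη, -⟩ := Finset.exists_ne_zero_of_sum_ne_zero h.ne'
    rw [Finset.mem_filter] at hη
    exact ⟨η, hη.1, lt_of_lt_of_le hη.2 ht⟩
  have hblock : ∀ B : Finset Θ, (∀ θ ∈ B, G θ ≠ 0 ∨ H θ ≠ 0) →
      (∀ θ ∈ B, ∀ η ∈ B, ‖(θ : Param q) - η‖ ≤ ε) → B.card ≤ 2 * d - 1 + 1 := by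
    intro B hB hdiam
    -- Each measure contributes at most `k + 1 - k₀ = d` atoms to the cluster.
    have h1 := card_add_card_le (B := B.filter (· ∈ G.support)) hsep'
      (fun θ hθ => hnear G ε (by linarith) θ (lt_trans (by positivity) (hmassG θ hθ)))
      (fun θ hθ => (Finset.mem_filter.1 hθ).2)
      (fun θ hθ η hη => hdiam θ (Finset.mem_filter.1 hθ).1 η (Finset.mem_filter.1 hη).1)
    have h2 := card_add_card_le (B := B.filter (· ∈ H.support)) hsep'
      (fun θ hθ => hnear H (2 * ε) le_rfl θ (hmassH θ hθ))
      (fun θ hθ => (Finset.mem_filter.1 hθ).2)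
      (fun θ hθ η hη => hdiam θ (Finset.mem_filter.1 hθ).1 η (Finset.mem_filter.1 hη).1)
    have h3 : B ⊆ B.filter (· ∈ G.support) ∪ B.filter (· ∈ H.support) := by
      intro θ hθ
      have := hB θ hθ
      simp only [Finset.mem_union, Finset.mem_filter, Finsupp.mem_support_iff]
      tauto
    have h4 := (Finset.card_le_card h3).trans (Finset.card_union_le _ _)
    have h5 := hG.2
    have h6 := hH.2
    omega
  have hle : C₂ * δ ≤ (C₂ + (2 * |R|) ^ (2 * d - 1) / δ₁) * δ := by
    gcongr
    exact le_add_of_nonneg_right (by positivity)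
  exact ⟨(hloc G hG H hH hblock δ hδ).trans hle,
    (hloc H hH G hG (fun B hB => hblock B fun θ hθ => (hB θ hθ).symm) δ
      fun α => by rw [abs_sub_comm]; exact hδ α).trans hle⟩

/-! ### From moments to estimators -/

theorem abs_centeredMoment_sub_le {m : ℕ} (θ₀ : Param q) (G : Θ →₀ ℝ) (v : MultiIndex q m → ℝ)
    (α : MultiIndex q m) : |centeredMoment θ₀ α.1 G - v α| ≤ momentDist θ₀ G v :=
  le_ciSup (f := fun α : MultiIndex q m => |centeredMoment θ₀ α.1 G - v α|)
    (Set.finite_range _).bddAbove α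

/-- `G` itself competes in the minimization, so the triangle inequality through the empirical
moments costs a factor `2`. -/
theorem IsGMM.abs_centeredMoment_sub_le {X : Type*} {θ₀ : Param q} {k n : ℕ}
    {T : MultiIndex q (2 * k - 1) → X → ℝ} {Ghat : (Fin n → X) → (Θ →₀ ℝ)}
    (h : IsGMM θ₀ k n T Ghat) {G : Θ →₀ ℝ} (hG : G ∈ atMostAtoms Θ k) (x : Fin n → X)
    (α : MultiIndex q (2 * k - 1)) :
    |centeredMoment θ₀ α.1 G - centeredMoment θ₀ α.1 (Ghat x)| ≤
      2 * momentDist θ₀ G (empMoment T x) := by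
  have h1 := MixtureGMM.abs_centeredMoment_sub_le θ₀ G (empMoment T x) α
  have h2 := MixtureGMM.abs_centeredMoment_sub_le θ₀ (Ghat x) (empMoment T x) α
  have h3 := (h x).2 G hG
  rw [abs_le] at h1 h2 ⊢
  constructor <;> linarith

/-- Scaling a measurable majorant of `g` by `c` gives one of `f`, so neither function has to be
measurable. -/
theorem outerExp_le_mul {Ω : Type*} [MeasurableSpace Ω] (μ : Measure Ω) {f g : Ω → ℝ} {c : ℝ}
    (hc : 0 < c) (h : ∀ ω, f ω ≤ c * g ω) :
    outerExp μ f ≤ ENNReal.ofReal c * outerExp μ g := by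
  have hc0 : ENNReal.ofReal c ≠ 0 := by simpa using hc
  unfold outerExp
  simp only [ENNReal.mul_iInf_of_ne hc0 ENNReal.ofReal_ne_top]
  refine le_iInf fun φ => le_iInf fun hφ => le_iInf fun hgφ => ?_
  rw [← lintegral_const_mul _ hφ]
  refine iInf_le_of_le (fun ω => ENNReal.ofReal c * φ ω) (iInf_le_of_le (hφ.const_mul _)
    (iInf_le_of_le (fun ω => ?_) le_rfl))
  calc ENNReal.ofReal (f ω) ≤ ENNReal.ofReal (c * g ω) := ENNReal.ofReal_le_ofReal (h ω)
    _ = ENNReal.ofReal c * ENNReal.ofReal (g ω) := ENNReal.ofReal_mul hc.le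
    _ ≤ _ := mul_le_mul' le_rfl (hgφ ω)

end MixtureGMM

/-! ### Assembly of the probability and expectation bounds -/

theorem theorem6 {q : ℕ} (Θ : Set (MixtureGMM.Param q)) (hΘ : IsCompact Θ)
    {X : Type*} [MeasurableSpace X] (P : Θ → Measure X) (hP : ∀ θ, IsProbabilityMeasure (P θ))
    (θ₀ : MixtureGMM.Param q) (k : ℕ) (hk : 1 ≤ k) :
    -- global bounds
    (∃ C c : ℝ, 0 < C ∧ 0 < c ∧
      ∀ T : MixtureGMM.MultiIndex q (2 * k - 1) → X → ℝ, MixtureGMM.IsUnbiased P θ₀ k T →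
      ∀ n : ℕ, 1 ≤ n →
      ∀ Ghat : (Fin n → X) → (Θ →₀ ℝ), MixtureGMM.IsGMM θ₀ k n T Ghat →
      ∀ G ∈ MixtureGMM.atMostAtoms Θ k,
        (∀ t : ℝ,
          MixtureGMM.sampleLaw P n G
              {x | t ≤ MixtureGMM.wasserstein (2 * k - 1) G (Ghat x) ^ (2 * k - 1)} ≤
            MixtureGMM.sampleLaw P n G
              {x | C * t ≤ MixtureGMM.momentDist θ₀ G (MixtureGMM.empMoment T x)}) ∧
        MixtureGMM.outerExp (MixtureGMM.sampleLaw P n G)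
            (fun x => MixtureGMM.wasserstein (2 * k - 1) G (Ghat x) ^ (2 * k - 1)) ≤
          ENNReal.ofReal c * MixtureGMM.outerExp (MixtureGMM.sampleLaw P n G)
            (fun x => MixtureGMM.momentDist θ₀ G (MixtureGMM.empMoment T x))) ∧
    -- local bounds near `G₀`, with `d₁ = k - k₀ + 1`
    (∀ k₀ : ℕ, 1 ≤ k₀ → k₀ ≤ k → ∀ G₀ ∈ MixtureGMM.exactAtoms Θ k₀,
      ∀ d₁ : ℕ, d₁ = k - k₀ + 1 →
      ∃ r C c : ℝ, 0 < r ∧ 0 < C ∧ 0 < c ∧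
      ∀ T : MixtureGMM.MultiIndex q (2 * k - 1) → X → ℝ, MixtureGMM.IsUnbiased P θ₀ k T →
      ∀ n : ℕ, 1 ≤ n →
      ∀ Ghat : (Fin n → X) → (Θ →₀ ℝ), MixtureGMM.IsGMM θ₀ k n T Ghat →
      ∀ G ∈ MixtureGMM.atMostAtoms Θ k, MixtureGMM.wasserstein 1 G₀ G < r →
        (∀ t : ℝ,
          MixtureGMM.sampleLaw P n G
              {x | t ≤ MixtureGMM.wasserstein (2 * d₁ - 1) G (Ghat x) ^ (2 * d₁ - 1)} ≤
            MixtureGMM.sampleLaw P n G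
              {x | C * min t 1 ≤ MixtureGMM.momentDist θ₀ G (MixtureGMM.empMoment T x)}) ∧
        MixtureGMM.outerExp (MixtureGMM.sampleLaw P n G)
            (fun x => MixtureGMM.wasserstein (2 * d₁ - 1) (Ghat x) G ^ (2 * d₁ - 1)) ≤
          ENNReal.ofReal c * MixtureGMM.outerExp (MixtureGMM.sampleLaw P n G)
            (fun x => MixtureGMM.momentDist θ₀ G (MixtureGMM.empMoment T x))) := by
  obtain ⟨R, hR⟩ := hΘ.isBounded.exists_norm_le
  have hR' : ∀ θ ∈ Θ, ‖θ - θ₀‖ ≤ R + ‖θ₀‖ := fun θ hθ =>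
    (norm_sub_le _ _).trans (by linarith [hR θ hθ])
  refine ⟨?_, fun k₀ hk₀ hkk G₀ hG₀ d hd => ?_⟩
  · obtain ⟨C, hC, h⟩ := MixtureGMM.exists_wasserstein_pow_le_global hR' hk
    refine ⟨1 / (C * 2), C * 2, by positivity, by positivity,
      fun T _ n _ Ghat hGhat G hG => ?_⟩
    have key : ∀ x, MixtureGMM.wasserstein (2 * k - 1) G (Ghat x) ^ (2 * k - 1) ≤
        C * 2 * MixtureGMM.momentDist θ₀ G (MixtureGMM.empMoment T x) := fun x => by
      rw [mul_assoc]
      exact h G hG _ (hGhat x).1 _ (hGhat.abs_centeredMoment_sub_le hG x)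
    refine ⟨fun t => measure_mono fun x hx => ?_, MixtureGMM.outerExp_le_mul _ (by positivity) key⟩
    rw [Set.mem_ofPred_eq, one_div, inv_mul_le_iff₀ (by positivity)]
    exact le_trans hx (key x)
  · obtain ⟨r, C, hr, hC, h⟩ :=
      MixtureGMM.exists_wasserstein_pow_le_local hR' hk₀ hkk hd hG₀
    refine ⟨r, 1 / (C * 2), C * 2, hr, by positivity, by positivity,
      fun T _ n _ Ghat hGhat G hG hGr => ?_⟩
    have key := fun x => h G hG _ (hGhat x).1 hGr _ (hGhat.abs_centeredMoment_sub_le hG x)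
    simp only [← mul_assoc] at key
    refine ⟨fun t => measure_mono fun x hx => ?_,
      MixtureGMM.outerExp_le_mul _ (by positivity) fun x => (key x).2⟩
    rw [Set.mem_ofPred_eq, one_div, inv_mul_le_iff₀ (by positivity)]
    -- The pointwise bound holds with `t` itself; the truncation at `1` only weakens it.
    exact (min_le_left t 1).trans (le_trans hx (key x).1)
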